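/- For a probability measure $\mu$ on $\mathbb{R}$ let $G_\mu(z)=\int \frac{1}{z-x}\,d\mu(x)$ and $K_\mu(z)=z-1/G_\mu(z)$ for $\operatorname{Im} z>0$. The Boolean convolution $\mu\uplus\nu$ of two probability measures $\mu,\nu$ on $\mathbb{R}$ is the unique probability measure on $\mathbb{R}$ with $K_{\mu\uplus\nu}=K_\mu+K_\nu$ on the upper half-plane, and $\mu^{\uplus n}$ denotes the $n$-fold Boolean convolution $\mu\uplus\cdots\uplus\mu$. Let $\mathrm{b}=\frac12\delta_{-1}+\frac12\delta_1$ be the Rademacher distribution. Let $W_2(\mu,\nu)=\inf_\pi\left(\iint|x-y|^2\,d\pi(x,y)\right)^{1/2}$, the infimum being over all couplings $\pi$ of $\mu$ and $\nu$. Define the Boolean Stein discrepancy by $D^*(\mu|\mathrm{b})=\left(\int(x^2-1)^2\,d\mu(x)\right)^{1/2}\in[0,+\infty]$, and write $m_k(\mu)=\int x^k\,d\mu(x)$. **Proposition (Berry–Esseen bound).** Let $\mu$ be a symmetric probability measure on $\mathbb{R}$ with $m_2(\mu)=1$ and $m_4(\mu)<\infty$. For an integer $n\ge 1$, let $\mu_n$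 be the dilation of $\mu^{\uplus n}$ by $1/\sqrt n$, i.e. $\mu_n(B)=\mu^{\uplus n}(\{x:\tfrac{1}{\sqrt n}x\in B\})$ for Borel sets $B$. Then, for every $n\ge1$, $$W_2(\mu_n,\mathrm{b})\le D^*(\mu_n|\mathrm{b})=\frac{1}{\sqrt n}\sqrt{m_4(\mu)-1}.$$ -/

import Mathlib

open MeasureTheory
open scoped ENNReal

noncomputable section

/-- The Cauchy transform `G_μ(z) = ∫ (z - x)⁻¹ dμ(x)` (used for `Im z > 0`). -/
def cauchyTransform (μ : Measure ℝ) (z : ℂ) : ℂ :=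
  ∫ x : ℝ, (z - (x : ℂ))⁻¹ ∂μ

/-- The self-energy `K_μ(z) = z - 1 / G_μ(z)` (used for `Im z > 0`, where `G_μ(z) ≠ 0` for every
probability measure `μ`). -/
def selfEnergy (μ : Measure ℝ) (z : ℂ) : ℂ :=
  z - (cauchyTransform μ z)⁻¹

/-- `ρ` is the Boolean convolution of `μ` and `ν`: it is a probability measure whose self-energy
is the sum of those of `μ` and `ν` on the upper half-plane. -/
def IsBooleanConv (μ ν ρ : Measure ℝ) : Prop :=
  IsProbabilityMeasure ρ ∧
    ∀ z : ℂ, 0 < z.im → selfEnergy ρ z = selfEnergy μ z + selfEnergy ν z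

open Classical in
/-- The Boolean convolution `μ ⊎ ν` of probability measures on the real line: the (unique)
probability measure with `K_{μ ⊎ ν} = K_μ + K_ν` on the upper half-plane.
The second branch is a placeholder: for probability measures `μ` and `ν` such a measure always
exists. -/
def booleanConv (μ ν : Measure ℝ) : Measure ℝ :=
  if h : ∃ ρ : Measure ℝ, IsBooleanConv μ ν ρ then h.choose else 0

/-- The `n`-fold Boolean convolution `μ ⊎ ⋯ ⊎ μ` (with the unit `δ₀` for `n = 0`). -/
def booleanPow (μ : Measure ℝ) : ℕ → Measure ℝ
  | 0 => Measure.dirac 0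
  | n + 1 => booleanConv (booleanPow μ n) μ

/-- The dilation of `μ` by `a`, i.e. `B ↦ μ {x | a * x ∈ B}`. -/
def dilation (a : ℝ) (μ : Measure ℝ) : Measure ℝ :=
  μ.map (fun x => a * x)

/-- The normalized Boolean sum `μ_n`: the dilation of the `n`-fold Boolean convolution of `μ` by
`1 / √n`. -/
def booleanCLT (μ : Measure ℝ) (n : ℕ) : Measure ℝ :=
  dilation (1 / √(n : ℝ)) (booleanPow μ n)

/-- The Rademacher distribution `b = (δ₋₁ + δ₁) / 2`. -/
def rademacher : Measure ℝ :=
  (2⁻¹ : ℝ≥0∞) • (Measure.dirac (-1) + Measure.dirac 1)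

/-- `π` is a coupling of `μ` and `ν`. -/
def IsCoupling (μ ν : Measure ℝ) (π : Measure (ℝ × ℝ)) : Prop :=
  π.map Prod.fst = μ ∧ π.map Prod.snd = ν

/-- The Wasserstein-`k` distance on the real line, as an extended nonnegative number. -/
def wassersteinDist (k : ℝ) (μ ν : Measure ℝ) : ℝ≥0∞ :=
  ⨅ (π : Measure (ℝ × ℝ)) (_ : IsCoupling μ ν π),
    (∫⁻ p : ℝ × ℝ, ENNReal.ofReal (|p.1 - p.2| ^ k) ∂π) ^ (1 / k)

/-- The Boolean Stein discrepancy `D*(μ|b) = (∫ (x² - 1)² dμ(x))^{1/2}`, with values in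
`[0, ∞]`. -/
def steinDiscrepancy (μ : Measure ℝ) : ℝ≥0∞ :=
  (∫⁻ x : ℝ, ENNReal.ofReal ((x ^ 2 - 1) ^ 2) ∂μ) ^ (1 / 2 : ℝ)

end

/-! Everything is read off the imaginary axis. Put `a_μ(y) = ∫ x²/(x²+y²) dμ`, so that `y · Im
G_μ(iy) = a_μ(y) - 1`. For symmetric `μ` the value `G_μ(iy)` is purely imaginary, and `K_ρ = t K_μ`
becomes `Re G_ρ(iy) = 0` together with `a_ρ (1 + (t-1) a_μ) = t a_μ`. Letting `y → ∞` gives `m₂(ρ) =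
t` and `m₄(ρ) = t (m₄(μ) + t - 1)` (`moments_of_booleanPower`); with `t = n`, expanding `(x²/n -
1)²` yields the discrepancy `(m₄(μ) - 1)/n`. Integrating `Re G_ρ(iy) = 0` over `y > 0` shows that
`ρ` charges both half-lines equally (`measure_Ioi_eq_measure_Iio`). Hence the sign of `x`, with the
mass at `0` split evenly, is Rademacher, and this coupling costs `(|x|-1)² ≤ (x²-1)²`. `booleanConv`
is defined by choice, so existence of the powers must be proved; uniqueness is never needed. Powers
are built from finite-dimensional operators, then by a weak limit (`exists_booleanPower`). -/

open Filter Topology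

/-! ### Boolean powers in finite dimension -/

section SpectralMeasure

variable {E : Type*} [NormedAddCommGroup E] [InnerProductSpace ℂ E]

theorem LinearMap.IsSymmetric.eq_zero_of_apply_eq_smul {T : E →ₗ[ℂ] E} (hT : T.IsSymmetric)
    {z : ℂ} (hz : 0 < z.im) {v : E} (hv : T v = z • v) : v = 0 := by
  have h := hT v v
  rw [hv, inner_smul_left, inner_smul_right, ← sub_eq_zero, ← sub_mul, mul_eq_zero] at h
  rcases h with h | h
  · have := congrArg Complex.im h
    simp at this
    linarith
  · exact inner_self_eq_zero.1 h

theorem LinearMap.IsSymmetric.exists_resolvent [FiniteDimensional ℂ E] {T : E →ₗ[ℂ] E}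
    (hT : T.IsSymmetric) {z : ℂ} (hz : 0 < z.im) (ξ : E) : ∃ u : E, z • u - T u = ξ := by
  have hinj : Function.Injective (z • LinearMap.id - T : E →ₗ[ℂ] E) := by
    rw [injective_iff_map_eq_zero]
    intro v hv
    refine hT.eq_zero_of_apply_eq_smul hz (v := v) ?_
    exact (sub_eq_zero.1 (by simpa using hv : z • v - T v = 0)).symm
  obtain ⟨u, hu⟩ := LinearMap.injective_iff_surjective.1 hinj ξ
  exact ⟨u, by simpa using hu⟩

/-- The spectral measure of a symmetric operator at a unit vector. -/
theorem LinearMap.IsSymmetric.exists_spectralMeasure [FiniteDimensional ℂ E] {T : E →ₗ[ℂ] E}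
    (hT : T.IsSymmetric) {ξ : E} (hξ : ‖ξ‖ = 1) :
    ∃ ρ : Measure ℝ, IsProbabilityMeasure ρ ∧
      (∀ z : ℂ, 0 < z.im → ∀ u : E, z • u - T u = ξ → cauchyTransform ρ z = inner ℂ ξ u) ∧
      ∫⁻ x, ENNReal.ofReal (x ^ 2) ∂ρ = ENNReal.ofReal (‖T ξ‖ ^ 2) := by
  classical
  set b := hT.eigenvectorBasis rfl with hb
  set l := hT.eigenvalues rfl with hl
  have hTb (i) (u : E) : inner ℂ (b i) (T u) = (l i : ℂ) * inner ℂ (b i) u := by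
    rw [← hT, hT.apply_eigenvectorBasis, inner_smul_left]
    simp [hb, hl]
  have hnorm (v : E) : ∑ i, ‖inner ℂ (b i) v‖ ^ 2 = ‖v‖ ^ 2 := b.sum_sq_norm_inner_right v
  refine ⟨∑ i, ENNReal.ofReal (‖inner ℂ (b i) ξ‖ ^ 2) • Measure.dirac (l i), ⟨?_⟩, ?_, ?_⟩
  · simp only [Measure.coe_finsetSum, Finset.sum_apply, Measure.smul_apply, measure_univ,
      smul_eq_mul, mul_one]
    rw [← ENNReal.ofReal_sum_of_nonneg (fun _ _ => by positivity), hnorm, hξ]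
    simp
  · intro z hz u hu
    unfold cauchyTransform
    rw [integral_finsetSum_measure]
    · rw [← b.sum_inner_mul_inner ξ u]
      refine Finset.sum_congr rfl fun i _ => ?_
      have hne : z - (l i : ℂ) ≠ 0 := by
        intro h
        have := congrArg Complex.im h
        simp at this
        exact hz.ne' this
      rw [integral_smul_measure, integral_dirac, ENNReal.toReal_ofReal (by positivity)]
      have h1 : inner ℂ (b i) ξ = (z - l i) * inner ℂ (b i) u := by
        rw [← hu, inner_sub_right, inner_smul_right, hTb]; ring
      have h2 : ((‖inner ℂ (b i) ξ‖ ^ 2 : ℝ) : ℂ) = inner ℂ ξ (b i) * inner ℂ (b i) ξ := by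
        rw [← inner_conj_symm ξ (b i), Complex.conj_mul']
        push_cast; rfl
      rw [Complex.real_smul, h2, h1]
      field_simp
    · intro i _
      exact (integrable_dirac (by simp)).smul_measure (by simp)
  · rw [lintegral_finsetSum_measure, ← hnorm (T ξ),
      ENNReal.ofReal_sum_of_nonneg (fun _ _ => by positivity)]
    refine Finset.sum_congr rfl fun i _ => ?_
    rw [lintegral_smul_measure, lintegral_dirac, hTb, smul_eq_mul,
      ← ENNReal.ofReal_mul (by positivity)]
    congr 1
    rw [norm_mul, mul_pow, Complex.norm_real, Real.norm_eq_abs, sq_abs]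
    ring

/-- The compression `R A R` with `R = 1 + (√t - 1) ⟪ξ, ·⟫ ξ` realizes the Boolean power of order
`t` of the spectral measure of `A` at `ξ`. -/
theorem LinearMap.IsSymmetric.exists_booleanPower [FiniteDimensional ℂ E] {A : E →ₗ[ℂ] E}
    (hA : A.IsSymmetric) {ξ : E} (hξ : ‖ξ‖ = 1) {t : ℝ} (ht : 1 ≤ t) :
    ∃ ρ : Measure ℝ, IsProbabilityMeasure ρ ∧
      (∀ z : ℂ, 0 < z.im → ∀ u : E, z • u - A u = ξ →
        cauchyTransform ρ z * (t + z * (1 - t) * inner ℂ ξ u) = inner ℂ ξ u) ∧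
      ∫⁻ x, ENNReal.ofReal (x ^ 2) ∂ρ ≤ ENNReal.ofReal (t ^ 2 * ‖A ξ‖ ^ 2) := by
  -- In blocks along `ξ` and its complement, `A = [a, b*; b, C]` and `K = a + b*(z-C)⁻¹b` by the
  -- Schur complement. Conjugation by `R` replaces `a` by `t a` and `b` by `√t b`, hence `K` by `t
  -- K`.
  set s : ℝ := √t with hs
  have hs1 : 1 ≤ s := Real.one_le_sqrt.2 ht
  have hst : s ^ 2 = t := Real.sq_sqrt (by linarith)
  have hξξ : inner ℂ ξ ξ = 1 := by simp [inner_self_eq_norm_sq_to_K, hξ]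
  set R : E →ₗ[ℂ] E :=
    LinearMap.id + ((s : ℂ) - 1) • (innerₛₗ ℂ ξ).smulRight ξ with hR
  have hRv (v : E) : R v = v + (((s : ℂ) - 1) * inner ℂ ξ v) • ξ := by
    simp [hR, smul_smul]
  have hRξ : R ξ = (s : ℂ) • ξ := by
    rw [hRv, hξξ]; module
  have hRinner (v : E) : inner ℂ ξ (R v) = s * inner ℂ ξ v := by
    rw [hRv, inner_add_right, inner_smul_right, hξξ]; ring
  have hRs : R.IsSymmetric := by
    intro v w
    rw [hRv, hRv, inner_add_left, inner_add_right, inner_smul_left, inner_smul_right]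
    simp
    ring
  have hRnorm (v : E) : ‖R v‖ ≤ s * ‖v‖ := by
    rw [hRv]
    refine (norm_add_le _ _).trans ?_
    rw [norm_smul, norm_mul, hξ]
    have h1 : ‖(s : ℂ) - 1‖ = s - 1 := by
      rw [← Complex.ofReal_one, ← Complex.ofReal_sub, Complex.norm_real, Real.norm_of_nonneg]
      linarith
    have h2 : ‖inner ℂ ξ v‖ ≤ ‖v‖ := by simpa [hξ] using norm_inner_le_norm (𝕜 := ℂ) ξ v
    rw [h1]
    nlinarith
  have hT : (R ∘ₗ A ∘ₗ R).IsSymmetric := by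
    intro v w
    simp only [LinearMap.comp_apply]
    rw [hRs, hA, hRs]
  obtain ⟨ρ, hρ, hG, hm⟩ := hT.exists_spectralMeasure hξ
  refine ⟨ρ, hρ, ?_, ?_⟩
  · intro z hz u hu
    obtain ⟨v, hv⟩ := hT.exists_resolvent hz ξ
    rw [hG z hz v hv]
    have hs0 : (s : ℂ) ≠ 0 := by exact_mod_cast (by linarith : s ≠ 0)
    set g := inner ℂ ξ v with hg
    -- Applying `R⁻¹` to `z v - RARv = ξ` gives `(z - A) R v = κ ξ`, because `R⁻¹v = R v + (1/s - s)
    -- g ξ`.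
    set κ : ℂ := (1 : ℂ) / s - z * ((1 : ℂ) / s - s) * g with hκ
    have hinv (w : E) : w = R w + (((1 : ℂ) / s - 1) * (s * inner ℂ ξ w)) • ξ := by
      rw [hRv, add_assoc, ← add_smul]
      have : ((s : ℂ) - 1) * inner ℂ ξ w + ((1 : ℂ) / s - 1) * (s * inner ℂ ξ w) = 0 := by
        field_simp; ring
      rw [this]; simp
    have hRinj (w w' : E) (h : R w = R w') : w = w' := by
      rw [hinv w, hinv w', h, ← hRinner, ← hRinner, h]
    have hk : z • R v - A (R v) = κ • ξ := by
      apply hRinj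
      have h1 : R (A (R v)) = z • v - ξ := by
        rw [← hv]; simp
      rw [map_sub, map_smul, map_smul, hRξ, h1, hRv (R v), hRinner, hRv v, ← hg, hκ]
      match_scalars
      · ring
      · field_simp
        ring
    have hRvu : R v = κ • u := by
      rw [← sub_eq_zero]
      refine hA.eq_zero_of_apply_eq_smul hz ?_
      rw [← hu] at hk
      rw [map_sub, map_smul]
      have : z • (R v - κ • u) = κ • (z • u - A u) + A (R v) - κ • z • u := by
        rw [← hk]; module
      rw [this]; module
    have h3 : s * g = κ * inner ℂ ξ u := by
      rw [hg, ← hRinner, hRvu, inner_smul_right]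
    have hst' : (t : ℂ) = s ^ 2 := by rw [← hst]; push_cast; rfl
    rw [hst']
    rw [hκ] at h3
    field_simp at h3
    linear_combination h3
  · rw [hm]
    refine ENNReal.ofReal_le_ofReal ?_
    simp only [LinearMap.comp_apply, hRξ, map_smul, norm_smul, Complex.norm_real]
    rw [Real.norm_of_nonneg (by linarith), ← hst, ← mul_pow]
    have := hRnorm (A ξ)
    refine pow_le_pow_left₀ (by positivity) ?_ 2
    nlinarith

end SpectralMeasure

/-- Boolean powers of finitely supported laws. -/
theorem exists_booleanPower_of_fintype {ι : Type*} [Fintype ι] (x p : ι → ℝ) (hp : ∀ i, 0 ≤ p i)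
    (hsum : ∑ i, p i = 1) {t : ℝ} (ht : 1 ≤ t) :
    ∃ ρ : Measure ℝ, IsProbabilityMeasure ρ ∧
      (∀ z : ℂ, 0 < z.im →
        cauchyTransform ρ z * (t + z * (1 - t) * ∑ i, (p i : ℂ) * (z - x i)⁻¹) =
          ∑ i, (p i : ℂ) * (z - x i)⁻¹) ∧
      ∫⁻ x, ENNReal.ofReal (x ^ 2) ∂ρ ≤ ENNReal.ofReal (t ^ 2 * ∑ i, p i * x i ^ 2) := by
  classical
  -- Multiplication by `x`, seen from the unit vector `√p`, has spectral law `∑ p i δ_{x i}`.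
  set A : EuclideanSpace ℂ ι →ₗ[ℂ] EuclideanSpace ℂ ι :=
    { toFun := fun v => WithLp.toLp 2 fun i => (x i : ℂ) * v i
      map_add' := fun v w => by ext i; simp [mul_add]
      map_smul' := fun c v => by ext i; simp; ring } with hAdef
  have hAv (v : EuclideanSpace ℂ ι) (i : ι) : A v i = (x i : ℂ) * v i := rfl
  have hA : A.IsSymmetric := by
    intro v w
    simp only [PiLp.inner_apply, hAv]
    refine Finset.sum_congr rfl fun i _ => ?_
    simp
    ring
  set ξ : EuclideanSpace ℂ ι := WithLp.toLp 2 fun i => (√(p i) : ℂ) with hξdef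
  have hξi (i : ι) : ξ i = (√(p i) : ℂ) := rfl
  have hξ2 (i : ι) : ‖ξ i‖ ^ 2 = p i := by
    rw [hξi, Complex.norm_real, Real.norm_eq_abs, sq_abs, Real.sq_sqrt (hp i)]
  have hξ : ‖ξ‖ = 1 := by
    rw [EuclideanSpace.norm_eq]; simp [hξ2, hsum]
  obtain ⟨ρ, hρ, hG, hm⟩ := hA.exists_booleanPower hξ ht
  refine ⟨ρ, hρ, ?_, ?_⟩
  · intro z hz
    set u : EuclideanSpace ℂ ι := WithLp.toLp 2 fun i => (√(p i) : ℂ) * (z - x i)⁻¹ with hu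
    have hu1 : z • u - A u = ξ := by
      ext i
      have hne : z - (x i : ℂ) ≠ 0 := by
        intro h
        have := congrArg Complex.im h
        simp at this
        exact hz.ne' this
      simp only [PiLp.sub_apply, PiLp.smul_apply, hAv, hξi, hu, smul_eq_mul]
      field_simp
    have hu2 : inner ℂ ξ u = ∑ i, (p i : ℂ) * (z - x i)⁻¹ := by
      simp only [PiLp.inner_apply, hξi, hu]
      refine Finset.sum_congr rfl fun i _ => ?_
      have : (p i : ℂ) = √(p i) * √(p i) := by
        rw [← Complex.ofReal_mul, Real.mul_self_sqrt (hp i)]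
      rw [this]
      simp
      ring
    rw [← hu2]
    exact hG z hz u hu1
  · refine hm.trans_eq ?_
    rw [EuclideanSpace.norm_sq_eq]
    congr 2
    refine Finset.sum_congr rfl fun i _ => ?_
    rw [hAv, norm_mul, mul_pow, hξ2, Complex.norm_real, Real.norm_eq_abs, sq_abs]
    ring

/-! ### Basic properties of the Cauchy transform -/

theorem sub_ofReal_ne_zero {z : ℂ} (hz : 0 < z.im) (x : ℝ) : z - (x : ℂ) ≠ 0 := by
  intro h
  have := congrArg Complex.im h
  simp at this
  exact hz.ne' this

theorem norm_inv_sub_ofReal_le {z : ℂ} (hz : 0 < z.im) (x : ℝ) :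
    ‖(z - (x : ℂ))⁻¹‖ ≤ z.im⁻¹ := by
  rw [norm_inv]
  refine inv_anti₀ hz ?_
  calc z.im = |(z - (x : ℂ)).im| := by simp [abs_of_pos hz]
    _ ≤ _ := Complex.abs_im_le_norm _

theorem continuous_inv_sub_ofReal {z : ℂ} (hz : 0 < z.im) :
    Continuous fun x : ℝ => (z - (x : ℂ))⁻¹ :=
  Continuous.inv₀ (by fun_prop) (sub_ofReal_ne_zero hz)

theorem integrable_inv_sub_ofReal (μ : Measure ℝ) [IsFiniteMeasure μ] {z : ℂ} (hz : 0 < z.im) :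
    Integrable (fun x : ℝ => (z - (x : ℂ))⁻¹) μ :=
  Integrable.of_bound (continuous_inv_sub_ofReal hz).aestronglyMeasurable _
    (ae_of_all _ (norm_inv_sub_ofReal_le hz))

theorem cauchyTransform_re (μ : Measure ℝ) [IsFiniteMeasure μ] {z : ℂ} (hz : 0 < z.im) :
    (cauchyTransform μ z).re = ∫ x : ℝ, (z.re - x) / Complex.normSq (z - x) ∂μ := by
  have := integral_re (integrable_inv_sub_ofReal μ hz)
  simp only [RCLike.re_to_complex, Complex.inv_re, Complex.sub_re, Complex.ofReal_re] at this
  exact this.symm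

theorem cauchyTransform_im (μ : Measure ℝ) [IsFiniteMeasure μ] {z : ℂ} (hz : 0 < z.im) :
    (cauchyTransform μ z).im = ∫ x : ℝ, -z.im / Complex.normSq (z - x) ∂μ := by
  have := integral_im (integrable_inv_sub_ofReal μ hz)
  simp only [RCLike.im_to_complex, Complex.inv_im, Complex.sub_im, Complex.ofReal_im,
    sub_zero] at this
  exact this.symm

theorem cauchyTransform_im_neg (μ : Measure ℝ) [IsProbabilityMeasure μ] {z : ℂ} (hz : 0 < z.im) :
    (cauchyTransform μ z).im < 0 := by
  have hpos (x : ℝ) : 0 < z.im / Complex.normSq (z - x) :=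
    div_pos hz (Complex.normSq_pos.2 (sub_ofReal_ne_zero hz x))
  rw [cauchyTransform_im μ hz]
  simp only [neg_div]
  rw [integral_neg, neg_lt_zero, integral_pos_iff_support_of_nonneg (fun x => (hpos x).le)]
  · have : Function.support (fun x : ℝ => z.im / Complex.normSq (z - x)) = Set.univ := by
      ext x; simp only [Function.mem_support, Set.mem_univ, iff_true]; exact (hpos x).ne'
    rw [this]; simp
  · have := (integrable_inv_sub_ofReal μ hz).im.neg
    refine this.congr (ae_of_all _ fun x => ?_)
    simp [neg_div]

theorem cauchyTransform_ne_zero (μ : Measure ℝ) [IsProbabilityMeasure μ] {z : ℂ} (hz : 0 < z.im) :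
    cauchyTransform μ z ≠ 0 := fun h => by
  have := cauchyTransform_im_neg μ hz
  rw [h] at this
  simp at this

/-! ### Boolean powers of laws with finite variance -/

/-- Boolean powers of the law of a simple function. -/
theorem exists_booleanPower_of_simpleFunc (μ : Measure ℝ) [IsProbabilityMeasure μ]
    (s : SimpleFunc ℝ ℝ) {t : ℝ} (ht : 1 ≤ t) :
    ∃ ρ : Measure ℝ, IsProbabilityMeasure ρ ∧
      (∀ z : ℂ, 0 < z.im →
        cauchyTransform ρ z * (t + z * (1 - t) * ∫ x : ℝ, (z - (s x : ℂ))⁻¹ ∂μ) =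
          ∫ x : ℝ, (z - (s x : ℂ))⁻¹ ∂μ) ∧
      ∫⁻ x, ENNReal.ofReal (x ^ 2) ∂ρ ≤ ENNReal.ofReal (t ^ 2 * ∫ x : ℝ, s x ^ 2 ∂μ) := by
  have hsum {F : Type} [NormedAddCommGroup F] [NormedSpace ℝ F] [CompleteSpace F] (g : ℝ → F) :
      ∫ x, g (s x) ∂μ = ∑ y : s.range, μ.real (s ⁻¹' {(y : ℝ)}) • g y := by
    have hpt (x : ℝ) :
        g (s x) = ∑ y ∈ s.range, (s ⁻¹' {y}).indicator (fun _ => g y) x := by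
      rw [Finset.sum_eq_single (s x)]
      · simp
      · intro y _ hy
        exact Set.indicator_of_notMem (fun h => hy (Eq.symm h)) _
      · exact fun h => (h (s.mem_range_self x)).elim
    simp_rw [hpt]
    rw [integral_finsetSum _ fun y _ =>
      (integrable_const _).indicator (s.measurableSet_preimage {y}),
      ← Finset.sum_coe_sort]
    exact Finset.sum_congr rfl fun y _ =>
      integral_indicator_const _ (s.measurableSet_preimage {(y : ℝ)})
  obtain ⟨ρ, hρ, hG, hm⟩ := exists_booleanPower_of_fintype (fun y : s.range => (y : ℝ))
    (fun y => μ.real (s ⁻¹' {(y : ℝ)})) (fun _ => measureReal_nonneg)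
    (by simpa using (hsum (fun _ => (1 : ℝ))).symm) ht
  refine ⟨ρ, hρ, fun z hz => ?_, ?_⟩
  · rw [hsum (fun y : ℝ => (z - (y : ℂ))⁻¹)]
    simpa only [Complex.real_smul] using hG z hz
  · rw [hsum (fun y : ℝ => y ^ 2)]
    exact hm

/-- Simple functions approximating the identity have laws whose powers have uniformly bounded second
moments, hence are tight. The division-free form of the self-energy identity passes to a weak limit,
since the kernel `(z - x)⁻¹` is bounded and continuous. -/
theorem exists_booleanPower (μ : Measure ℝ) [IsProbabilityMeasure μ]
    (hμ : Integrable (fun x : ℝ => x ^ 2) μ) {t : ℝ} (ht : 1 ≤ t) :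
    ∃ ρ : Measure ℝ, IsProbabilityMeasure ρ ∧
      ∀ z : ℂ, 0 < z.im → selfEnergy ρ z = t * selfEnergy μ z := by
  set s : ℕ → SimpleFunc ℝ ℝ := SimpleFunc.approxOn id measurable_id Set.univ 0 trivial with hs
  have hsle (k : ℕ) (x : ℝ) : |s k x| ≤ 2 * |x| := by
    have := SimpleFunc.norm_approxOn_zero_le (f := id) measurable_id
      (s := Set.univ) (Set.mem_univ (0 : ℝ)) x k
    simp only [Real.norm_eq_abs, id] at this
    linarith
  have hslim (x : ℝ) : Tendsto (fun k => s k x) atTop (𝓝 x) :=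
    SimpleFunc.tendsto_approxOn (f := id) measurable_id (s := Set.univ) (Set.mem_univ (0 : ℝ))
      (by simp)
  choose ρ hρ hG hm using fun k => exists_booleanPower_of_simpleFunc μ (s k) ht
  set M : ℝ := t ^ 2 * (4 * ∫ x, x ^ 2 ∂μ) with hM
  have hM0 : 0 ≤ M := by positivity
  have hmM (k : ℕ) : ∫⁻ x, ENNReal.ofReal (x ^ 2) ∂(ρ k) ≤ ENNReal.ofReal M := by
    refine (hm k).trans (ENNReal.ofReal_le_ofReal ?_)
    refine mul_le_mul_of_nonneg_left ?_ (sq_nonneg t)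
    rw [← integral_const_mul]
    refine integral_mono_of_nonneg (ae_of_all _ fun x => by positivity) (hμ.const_mul 4)
      (ae_of_all _ fun x => ?_)
    have := pow_le_pow_left₀ (abs_nonneg _) (hsle k x) 2
    rw [mul_pow, sq_abs, sq_abs] at this
    linarith
  set P : ℕ → ProbabilityMeasure ℝ := fun k => ⟨ρ k, hρ k⟩ with hP
  -- Chebyshev bound for the mass outside `[-(j+1), j+1]`.
  set u : ℕ → NNReal := fun j => (M / ((j : ℝ) + 1) ^ 2).toNNReal with hu
  set K : ℕ → Set ℝ := fun j => Set.Icc (-((j : ℝ) + 1)) (j + 1) with hK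
  have hulim : Tendsto u atTop (𝓝 0) := by
    rw [← Real.toNNReal_zero]
    refine (continuous_real_toNNReal.tendsto 0).comp ?_
    refine Tendsto.div_atTop tendsto_const_nhds ?_
    exact (tendsto_pow_atTop two_ne_zero).comp
      (tendsto_atTop_add_const_right _ _ tendsto_natCast_atTop_atTop)
  have hcomp := isCompact_setOfPred_probabilityMeasure_mass_eq_compl_isCompact_le hulim
    (K := K) (fun j => isCompact_Icc) (Or.inl inferInstance)
  have hPmem (k : ℕ) : P k ∈ {ν : ProbabilityMeasure ℝ | ∀ j, ν (K j)ᶜ ≤ u j} := by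
    intro j
    have hj : (0 : ℝ) < ((j : ℝ) + 1) ^ 2 := by positivity
    have hmark := meas_ge_le_lintegral_div (μ := ρ k)
      (f := fun x : ℝ => ENNReal.ofReal (x ^ 2)) (by fun_prop)
      (ε := ENNReal.ofReal (((j : ℝ) + 1) ^ 2)) (by rw [Ne, ENNReal.ofReal_eq_zero]; linarith) (by simp)
    have hsub : (K j)ᶜ ⊆ {x : ℝ | ENNReal.ofReal (((j : ℝ) + 1) ^ 2) ≤ ENNReal.ofReal (x ^ 2)} := by
      intro x hx
      refine ENNReal.ofReal_le_ofReal ?_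
      rw [sq_le_sq, abs_of_pos (by positivity : (0 : ℝ) < (j : ℝ) + 1)]
      by_contra! h
      exact hx (abs_le.1 h.le)
    rw [← ENNReal.coe_le_coe, ProbabilityMeasure.ennreal_coeFn_eq_coeFn_toMeasure]
    refine (measure_mono hsub).trans (hmark.trans ?_)
    rw [hu]
    change _ ≤ ENNReal.ofReal _
    rw [ENNReal.ofReal_div_of_pos hj]
    gcongr
    exact hmM k
  -- A limit along a nonprincipal ultrafilter replaces the extraction of a subsequence.
  obtain ⟨Q, -, hQ⟩ := hcomp.ultrafilter_le_nhds' ((hyperfilter ℕ).map P)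
    (Ultrafilter.mem_map.2 (Filter.univ_mem' hPmem))
  have hQ' : Tendsto P (hyperfilter ℕ : Filter ℕ) (𝓝 Q) := hQ
  refine ⟨Q, inferInstance, fun z hz => ?_⟩
  set g : BoundedContinuousFunction ℝ ℂ := BoundedContinuousFunction.ofNormedAddCommGroup
    (fun x : ℝ => (z - (x : ℂ))⁻¹) (continuous_inv_sub_ofReal hz) z.im⁻¹
    (norm_inv_sub_ofReal_le hz) with hg
  have h1 : Tendsto (fun k => cauchyTransform (ρ k) z) (hyperfilter ℕ : Filter ℕ)
      (𝓝 (cauchyTransform (Q : Measure ℝ) z)) :=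
    (ProbabilityMeasure.tendsto_iff_forall_integral_rclike_tendsto ℂ).1 hQ' g
  have h2 : Tendsto (fun k => ∫ x : ℝ, (z - (s k x : ℂ))⁻¹ ∂μ) (hyperfilter ℕ : Filter ℕ)
      (𝓝 (cauchyTransform μ z)) := by
    refine Tendsto.mono_left ?_ (Nat.hyperfilter_le_atTop)
    refine tendsto_integral_of_dominated_convergence (fun _ => z.im⁻¹) (fun k => ?_)
      (integrable_const _) (fun k => ae_of_all _ fun x => norm_inv_sub_ofReal_le hz _)
      (ae_of_all _ fun x => ?_)
    · exact ((continuous_inv_sub_ofReal hz).measurable.comp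
        (s k).measurable).aestronglyMeasurable
    · exact ((continuous_inv_sub_ofReal hz).tendsto x).comp (hslim x)
  have h3 := tendsto_nhds_unique (f := fun k => ∫ x : ℝ, (z - (s k x : ℂ))⁻¹ ∂μ)
    ((h1.mul (tendsto_const_nhds.add (h2.const_mul (z * (1 - t))))).congr fun k => hG k z hz) h2
  have hG0 := cauchyTransform_ne_zero μ hz
  have hQ0 := cauchyTransform_ne_zero (Q : Measure ℝ) hz
  unfold selfEnergy
  field_simp
  linear_combination h3

theorem booleanConv_spec {μ ν : Measure ℝ} (h : ∃ ρ, IsBooleanConv μ ν ρ) :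
    IsBooleanConv μ ν (booleanConv μ ν) := by
  unfold booleanConv
  rw [dif_pos h]
  exact h.choose_spec

theorem booleanPow_spec (μ : Measure ℝ) [IsProbabilityMeasure μ]
    (hμ : Integrable (fun x : ℝ => x ^ 2) μ) (n : ℕ) :
    IsProbabilityMeasure (booleanPow μ n) ∧
      ∀ z : ℂ, 0 < z.im → selfEnergy (booleanPow μ n) z = n * selfEnergy μ z := by
  induction n with
  | zero =>
    refine ⟨Measure.dirac.isProbabilityMeasure, fun z _ => ?_⟩
    simp [booleanPow, selfEnergy, cauchyTransform]
  | succ n ih =>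
    obtain ⟨ρ, hρ, hK⟩ := exists_booleanPower μ hμ (t := (n : ℝ) + 1) (by simp)
    have := booleanConv_spec (μ := booleanPow μ n) (ν := μ)
      ⟨ρ, hρ, fun z hz => by rw [hK z hz, ih.2 z hz]; push_cast; ring⟩
    refine ⟨this.1, fun z hz => ?_⟩
    rw [booleanPow, this.2 z hz, ih.2 z hz]
    push_cast
    ring

/-! ### The imaginary axis -/

theorem normSq_mul_I_sub_ofReal (y x : ℝ) :
    Complex.normSq ((y : ℂ) * Complex.I - x) = x ^ 2 + y ^ 2 := by
  simp [Complex.normSq_apply]; ring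

theorem mul_I_im_pos {y : ℝ} (hy : 0 < y) : 0 < ((y : ℂ) * Complex.I).im := by simpa using hy

theorem cauchyTransform_mul_I_re (μ : Measure ℝ) [IsFiniteMeasure μ] {y : ℝ} (hy : 0 < y) :
    (cauchyTransform μ (y * Complex.I)).re = -∫ x : ℝ, x / (x ^ 2 + y ^ 2) ∂μ := by
  rw [cauchyTransform_re μ (mul_I_im_pos hy), ← integral_neg]
  simp [normSq_mul_I_sub_ofReal, neg_div]

theorem cauchyTransform_mul_I_re_eq_zero_of_symm (μ : Measure ℝ) [IsFiniteMeasure μ]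
    (hμ : μ.map (fun x : ℝ => -x) = μ) {y : ℝ} (hy : 0 < y) :
    (cauchyTransform μ (y * Complex.I)).re = 0 := by
  rw [cauchyTransform_mul_I_re μ hy, neg_eq_zero]
  have h : ∫ x : ℝ, x / (x ^ 2 + y ^ 2) ∂μ = -∫ x : ℝ, x / (x ^ 2 + y ^ 2) ∂μ := by
    conv_lhs => rw [← hμ]
    rw [integral_map (by fun_prop) (Measurable.aestronglyMeasurable (by fun_prop)), ← integral_neg]
    simp [neg_div]
  linarith

theorem integrable_sq_div_add_sq (μ : Measure ℝ) [IsFiniteMeasure μ] (y : ℝ) :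
    Integrable (fun x : ℝ => x ^ 2 / (x ^ 2 + y ^ 2)) μ := by
  refine Integrable.of_bound (Measurable.aestronglyMeasurable (by fun_prop)) 1 (ae_of_all _ fun x => ?_)
  rw [Real.norm_of_nonneg (by positivity)]
  exact div_le_one_of_le₀ (by nlinarith [sq_nonneg y]) (by positivity)

theorem mul_cauchyTransform_mul_I_im (μ : Measure ℝ) [IsProbabilityMeasure μ] {y : ℝ}
    (hy : 0 < y) :
    y * (cauchyTransform μ (y * Complex.I)).im = (∫ x : ℝ, x ^ 2 / (x ^ 2 + y ^ 2) ∂μ) - 1 := by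
  rw [cauchyTransform_im μ (mul_I_im_pos hy), ← integral_const_mul]
  have : (1 : ℝ) = ∫ _ : ℝ, 1 ∂μ := by simp
  rw [this, ← integral_sub (integrable_sq_div_add_sq μ y) (integrable_const _)]
  refine integral_congr_ae (ae_of_all _ fun x => ?_)
  have : x ^ 2 + y ^ 2 ≠ 0 := by positivity
  simp only [normSq_mul_I_sub_ofReal, Complex.mul_im, Complex.I_im, Complex.I_re,
    Complex.ofReal_re, Complex.ofReal_im]
  field_simp
  ring

section Power

variable {μ ρ : Measure ℝ} [IsProbabilityMeasure μ] [IsProbabilityMeasure ρ] {t : ℝ}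

theorem cauchyTransform_mul_of_selfEnergy_eq {z : ℂ} (hz : 0 < z.im)
    (h : selfEnergy ρ z = t * selfEnergy μ z) :
    cauchyTransform ρ z * (t + z * (1 - t) * cauchyTransform μ z) = cauchyTransform μ z := by
  have h1 := cauchyTransform_ne_zero μ hz
  have h2 := cauchyTransform_ne_zero ρ hz
  unfold selfEnergy at h
  field_simp at h
  linear_combination h

/-- When `G_μ(iy)` is purely imaginary, the factor `t + iy(1-t) G_μ(iy)` is real, so the real and
imaginary parts of the identity decouple. -/
theorem cauchyTransform_mul_I_re_im_of_selfEnergy_eq {y : ℝ} (hy : 0 < y)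
    (hre : (cauchyTransform μ (y * Complex.I)).re = 0)
    (h : selfEnergy ρ (y * Complex.I) = t * selfEnergy μ (y * Complex.I)) :
    (cauchyTransform ρ (y * Complex.I)).re = 0 ∧
      (∫ x : ℝ, x ^ 2 / (x ^ 2 + y ^ 2) ∂ρ) *
        (1 + (t - 1) * ∫ x : ℝ, x ^ 2 / (x ^ 2 + y ^ 2) ∂μ) =
          t * ∫ x : ℝ, x ^ 2 / (x ^ 2 + y ^ 2) ∂μ := by
  have hz := mul_I_im_pos hy
  have key := cauchyTransform_mul_of_selfEnergy_eq hz h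
  have hneg := cauchyTransform_im_neg μ hz
  have hμy := mul_cauchyTransform_mul_I_im μ hy
  have hρy := mul_cauchyTransform_mul_I_im ρ hy
  set G := cauchyTransform μ (y * Complex.I)
  set G' := cauchyTransform ρ (y * Complex.I)
  have hG : G = (G.im : ℂ) * Complex.I := by
    apply Complex.ext <;> simp [hre]
  have hc : (t + y * Complex.I * (1 - t) * G : ℂ) = ((t - (1 - t) * (y * G.im) : ℝ) : ℂ) := by
    conv_lhs => rw [hG]
    push_cast
    linear_combination (1 - t : ℂ) * y * G.im * Complex.I_sq
  rw [hc] at key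
  have kre := congrArg Complex.re key
  have kim := congrArg Complex.im key
  rw [Complex.re_mul_ofReal, hre] at kre
  rw [Complex.im_mul_ofReal] at kim
  constructor
  -- If the real factor vanished, `Im G_μ(iy)` would be zero.
  · refine (mul_eq_zero.1 kre).resolve_right fun h0 => ?_
    rw [h0, mul_zero] at kim
    exact hneg.ne kim.symm
  · have h1 : y * G'.im * (t - (1 - t) * (y * G.im)) = y * G.im := by
      linear_combination y * kim
    rw [hμy, hρy] at h1
    linear_combination h1

end Power

/-! ### Moments from the behaviour at infinity -/

theorem tendsto_weight (x : ℝ) :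
    Tendsto (fun k : ℕ => ((k : ℝ) + 1) ^ 2 / (x ^ 2 + ((k : ℝ) + 1) ^ 2)) atTop (𝓝 1) := by
  have h1 : Tendsto (fun k : ℕ => ((k : ℝ) + 1) ^ 2) atTop atTop :=
    (tendsto_pow_atTop two_ne_zero).comp
      (tendsto_atTop_add_const_right _ _ tendsto_natCast_atTop_atTop)
  have h2 : Tendsto (fun k : ℕ => 1 - x ^ 2 / (x ^ 2 + ((k : ℝ) + 1) ^ 2)) atTop (𝓝 (1 - 0)) :=
    tendsto_const_nhds.sub
      (tendsto_const_nhds.div_atTop (tendsto_atTop_add_const_left _ _ h1))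
  rw [sub_zero] at h2
  refine h2.congr fun k => ?_
  have : x ^ 2 + ((k : ℝ) + 1) ^ 2 ≠ 0 := by positivity
  field_simp
  ring

/-- Monotone convergence, the weights increasing to `1`. As `f` itself is not assumed integrable,
this proves finiteness of the moments of `ρ`. -/
theorem lintegral_eq_of_tendsto_weight {ν : Measure ℝ} {f : ℝ → ℝ} (hf : Measurable f)
    (hf0 : ∀ x, 0 ≤ f x)
    (hint : ∀ k : ℕ,
      Integrable (fun x => f x * (((k : ℝ) + 1) ^ 2 / (x ^ 2 + ((k : ℝ) + 1) ^ 2))) ν)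
    {L : ℝ}
    (hL : Tendsto
      (fun k : ℕ => ∫ x, f x * (((k : ℝ) + 1) ^ 2 / (x ^ 2 + ((k : ℝ) + 1) ^ 2)) ∂ν)
      atTop (𝓝 L)) :
    ∫⁻ x, ENNReal.ofReal (f x) ∂ν = ENNReal.ofReal L := by
  have h1 := lintegral_tendsto_of_tendsto_of_monotone (μ := ν)
    (f := fun (k : ℕ) x =>
      ENNReal.ofReal (f x * (((k : ℝ) + 1) ^ 2 / (x ^ 2 + ((k : ℝ) + 1) ^ 2))))
    (F := fun x => ENNReal.ofReal (f x)) (fun k => by fun_prop)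
    (ae_of_all _ fun x i j hij => ?_) (ae_of_all _ fun x => ?_)
  · refine tendsto_nhds_unique h1 (((ENNReal.continuous_ofReal.tendsto L).comp hL).congr fun k => ?_)
    exact ofReal_integral_eq_lintegral_ofReal (hint k)
      (ae_of_all _ fun x => mul_nonneg (hf0 x) (by positivity))
  · refine ENNReal.ofReal_le_ofReal (mul_le_mul_of_nonneg_left ?_ (hf0 x))
    have hij' : ((i : ℝ) + 1) ^ 2 ≤ ((j : ℝ) + 1) ^ 2 := by
      have : (i : ℝ) ≤ j := by exact_mod_cast hij
      gcongr
    rw [div_le_div_iff₀ (by positivity) (by positivity)]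
    nlinarith [mul_le_mul_of_nonneg_left hij' (sq_nonneg x)]
  · have := (tendsto_weight x).const_mul (f x)
    rw [mul_one] at this
    exact (ENNReal.continuous_ofReal.tendsto _).comp this

theorem tendsto_integral_weight {ν : Measure ℝ} {f : ℝ → ℝ} (hf : Integrable f ν) :
    Tendsto (fun k : ℕ => ∫ x, f x * (((k : ℝ) + 1) ^ 2 / (x ^ 2 + ((k : ℝ) + 1) ^ 2)) ∂ν)
      atTop (𝓝 (∫ x, f x ∂ν)) := by
  refine tendsto_integral_of_dominated_convergence (fun x => ‖f x‖)
    (fun k => hf.aestronglyMeasurable.mul (Measurable.aestronglyMeasurable (by fun_prop))) hf.norm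
    (fun k => ae_of_all _ fun x => ?_) (ae_of_all _ fun x => ?_)
  · rw [norm_mul]
    refine mul_le_of_le_one_right (norm_nonneg _) ?_
    rw [Real.norm_of_nonneg (by positivity)]
    exact div_le_one_of_le₀ (by nlinarith [sq_nonneg x]) (by positivity)
  · simpa using (tendsto_weight x).const_mul (f x)

theorem integrable_of_lintegral_ofReal_eq {ν : Measure ℝ} {f : ℝ → ℝ} (hf : Measurable f)
    (hf0 : ∀ x, 0 ≤ f x) {L : ℝ} (hL : 0 ≤ L)
    (h : ∫⁻ x, ENNReal.ofReal (f x) ∂ν = ENNReal.ofReal L) :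
    Integrable f ν ∧ ∫ x, f x ∂ν = L := by
  refine ⟨⟨hf.aestronglyMeasurable, ?_⟩, ?_⟩
  · rw [hasFiniteIntegral_iff_ofReal (ae_of_all _ hf0), h]
    exact ENNReal.ofReal_lt_top
  · rw [integral_eq_lintegral_of_nonneg_ae (ae_of_all _ hf0) hf.aestronglyMeasurable, h,
      ENNReal.toReal_ofReal hL]

theorem integral_sq_mul_weight (ν : Measure ℝ) (y : ℝ) :
    ∫ x, x ^ 2 * (y ^ 2 / (x ^ 2 + y ^ 2)) ∂ν =
      y ^ 2 * ∫ x : ℝ, x ^ 2 / (x ^ 2 + y ^ 2) ∂ν := by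
  rw [← integral_const_mul]
  exact integral_congr_ae (ae_of_all _ fun x => by ring)

theorem integrable_sq_mul_weight (ν : Measure ℝ) [IsFiniteMeasure ν] (y : ℝ) :
    Integrable (fun x : ℝ => x ^ 2 * (y ^ 2 / (x ^ 2 + y ^ 2))) ν :=
  ((integrable_sq_div_add_sq ν y).const_mul (y ^ 2)).congr (ae_of_all _ fun x => by ring)

theorem pow_four_mul_weight (x : ℝ) {y : ℝ} (hy : 0 < y) :
    x ^ 4 * (y ^ 2 / (x ^ 2 + y ^ 2)) = y ^ 2 * (x ^ 2 - x ^ 2 * (y ^ 2 / (x ^ 2 + y ^ 2))) := by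
  have : x ^ 2 + y ^ 2 ≠ 0 := by positivity
  field_simp
  ring

theorem integrable_pow_four_mul_weight {ν : Measure ℝ} [IsFiniteMeasure ν]
    (hν : Integrable (fun x : ℝ => x ^ 2) ν) {y : ℝ} (hy : 0 < y) :
    Integrable (fun x : ℝ => x ^ 4 * (y ^ 2 / (x ^ 2 + y ^ 2))) ν := by
  simp_rw [pow_four_mul_weight _ hy]
  exact (hν.sub (integrable_sq_mul_weight ν y)).const_mul _

theorem integral_pow_four_mul_weight {ν : Measure ℝ} [IsFiniteMeasure ν]
    (hν : Integrable (fun x : ℝ => x ^ 2) ν) {y : ℝ} (hy : 0 < y) :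
    ∫ x, x ^ 4 * (y ^ 2 / (x ^ 2 + y ^ 2)) ∂ν =
      y ^ 2 * ((∫ x, x ^ 2 ∂ν) - y ^ 2 * ∫ x : ℝ, x ^ 2 / (x ^ 2 + y ^ 2) ∂ν) := by
  simp_rw [pow_four_mul_weight _ hy]
  rw [integral_const_mul, integral_sub hν (integrable_sq_mul_weight ν y), integral_sq_mul_weight]

/-- The second and fourth moments of a Boolean power. -/
theorem moments_of_booleanPower {μ ρ : Measure ℝ} [IsProbabilityMeasure μ]
    [IsProbabilityMeasure ρ] {t : ℝ} (ht : 1 ≤ t)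
    (hm2 : ∫ x : ℝ, x ^ 2 ∂μ = 1) (hm4 : Integrable (fun x : ℝ => x ^ 4) μ)
    (h : ∀ y : ℝ, 0 < y → (∫ x : ℝ, x ^ 2 / (x ^ 2 + y ^ 2) ∂ρ) *
        (1 + (t - 1) * ∫ x : ℝ, x ^ 2 / (x ^ 2 + y ^ 2) ∂μ) =
          t * ∫ x : ℝ, x ^ 2 / (x ^ 2 + y ^ 2) ∂μ) :
    (Integrable (fun x : ℝ => x ^ 2) ρ ∧ ∫ x : ℝ, x ^ 2 ∂ρ = t) ∧
      (Integrable (fun x : ℝ => x ^ 4) ρ ∧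
        ∫ x : ℝ, x ^ 4 ∂ρ = t * ((∫ x : ℝ, x ^ 4 ∂μ) + (t - 1))) := by
  -- A non-integrable function has integral `0` by convention, so the value `1` forces
  -- integrability.
  have hi2 : Integrable (fun x : ℝ => x ^ 2) μ := by
    by_contra hn
    rw [integral_undef hn] at hm2
    exact zero_ne_one hm2
  set a : ℕ → ℝ := fun k => ∫ x : ℝ, x ^ 2 / (x ^ 2 + ((k : ℝ) + 1) ^ 2) ∂μ with ha
  set a' : ℕ → ℝ := fun k => ∫ x : ℝ, x ^ 2 / (x ^ 2 + ((k : ℝ) + 1) ^ 2) ∂ρ with ha'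
  have hk (k : ℕ) : (0 : ℝ) < (k : ℝ) + 1 := by positivity
  have ha0 (k : ℕ) : 0 ≤ a k := integral_nonneg fun x => by positivity
  have hden (k : ℕ) : 0 < 1 + (t - 1) * a k := by
    have := mul_nonneg (sub_nonneg.2 ht) (ha0 k)
    linarith
  have haa (k : ℕ) : a' k = t * a k / (1 + (t - 1) * a k) := by
    rw [eq_div_iff (hden k).ne']
    exact h _ (hk k)
  have hA : Tendsto (fun k : ℕ => ((k : ℝ) + 1) ^ 2 * a k) atTop (𝓝 1) := by
    have := tendsto_integral_weight hi2
    rw [hm2] at this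
    exact this.congr fun k => integral_sq_mul_weight μ _
  have ha_lim : Tendsto a atTop (𝓝 0) := by
    have hinf : Tendsto (fun k : ℕ => ((k : ℝ) + 1) ^ 2) atTop atTop :=
      (tendsto_pow_atTop two_ne_zero).comp
        (tendsto_atTop_add_const_right _ _ tendsto_natCast_atTop_atTop)
    refine (hA.div_atTop hinf).congr fun k => ?_
    have := hk k
    field_simp
  have hB : Tendsto (fun k : ℕ => ((k : ℝ) + 1) ^ 2 * (1 - ((k : ℝ) + 1) ^ 2 * a k)) atTop
      (𝓝 (∫ x : ℝ, x ^ 4 ∂μ)) := by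
    refine (tendsto_integral_weight hm4).congr fun k => ?_
    rw [integral_pow_four_mul_weight hi2 (hk k), hm2]
  have hD : Tendsto (fun k => 1 + (t - 1) * a k) atTop (𝓝 1) := by
    simpa using (ha_lim.const_mul (t - 1)).const_add 1
  have hA' : Tendsto (fun k : ℕ => ((k : ℝ) + 1) ^ 2 * a' k) atTop (𝓝 t) := by
    have := (hA.const_mul t).div hD one_ne_zero
    rw [mul_one, div_one] at this
    refine this.congr fun k => ?_
    simp only [Pi.div_apply]
    rw [haa]; ring
  have h2 := integrable_of_lintegral_ofReal_eq (ν := ρ) (by fun_prop) (fun x => sq_nonneg x)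
    (by linarith : 0 ≤ t)
    (lintegral_eq_of_tendsto_weight (f := fun x => x ^ 2) (by fun_prop) (fun x => sq_nonneg x)
      (fun k => integrable_sq_mul_weight ρ _)
      (hA'.congr fun k => (integral_sq_mul_weight ρ _).symm))
  refine ⟨h2, ?_⟩
  -- With `y = k + 1`, the relation between `a'` and `a` gives `y²(t - y² a') = t [y²(1 - y² a) +
  -- (t-1) y² a] / (1 + (t-1) a)`.
  have hB' : Tendsto (fun k : ℕ => ((k : ℝ) + 1) ^ 2 * (t - ((k : ℝ) + 1) ^ 2 * a' k)) atTop
      (𝓝 (t * ((∫ x : ℝ, x ^ 4 ∂μ) + (t - 1)))) := by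
    have := ((hB.add (hA.const_mul (t - 1))).const_mul t).div hD one_ne_zero
    rw [mul_one, div_one] at this
    refine this.congr fun k => ?_
    simp only [Pi.div_apply]
    rw [div_eq_iff (hden k).ne']
    linear_combination ((k : ℝ) + 1) ^ 4 * h _ (hk k)
  have h40 (x : ℝ) : 0 ≤ x ^ 4 := by positivity
  refine integrable_of_lintegral_ofReal_eq (by fun_prop) h40
    (mul_nonneg (by linarith) (add_nonneg (integral_nonneg h40) (by linarith)))
    (lintegral_eq_of_tendsto_weight (f := fun x => x ^ 4) (by fun_prop) h40
      (fun k => integrable_pow_four_mul_weight h2.1 (hk k)) (hB'.congr fun k => ?_))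
  rw [integral_pow_four_mul_weight h2.1 (hk k), h2.2]

/-! ### Balance of the half-lines -/

/-- By scaling, the integral over `y` does not depend on `r`: integrating `x/(x²+y²)` over heights
retains only the sign of `x`. -/
theorem lintegral_Ioi_poisson {r : ℝ} (hr : 0 < r) :
    ∫⁻ y in Set.Ioi (0 : ℝ), ENNReal.ofReal (r / (r ^ 2 + y ^ 2)) =
      ENNReal.ofReal (Real.pi / 2) := by
  have hform (y : ℝ) : r / (r ^ 2 + y ^ 2) = r⁻¹ * (1 + (r⁻¹ * y) ^ 2)⁻¹ := by
    have : r ^ 2 + y ^ 2 ≠ 0 := by positivity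
    have h2 : 1 + (r⁻¹ * y) ^ 2 ≠ 0 := by positivity
    field_simp
  have hint : Integrable (fun y : ℝ => r / (r ^ 2 + y ^ 2)) := by
    simp_rw [hform]
    exact (integrable_inv_one_add_sq.comp_mul_left' (inv_ne_zero hr.ne')).const_mul _
  rw [← ofReal_integral_eq_lintegral_ofReal hint.integrableOn
    (ae_of_all _ fun y => by positivity)]
  congr 1
  simp_rw [hform]
  rw [integral_const_mul, integral_comp_mul_left_Ioi (fun y => (1 + y ^ 2)⁻¹) 0 (inv_pos.2 hr),
    mul_zero, integral_Ioi_inv_one_add_sq]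
  simp [hr.ne']

/-- A law whose Cauchy transform is purely imaginary on the imaginary axis charges both half-lines
equally. -/
theorem measure_Ioi_eq_measure_Iio (ρ : Measure ℝ) [IsProbabilityMeasure ρ]
    (h : ∀ y : ℝ, 0 < y → (cauchyTransform ρ (y * Complex.I)).re = 0) :
    ρ (Set.Ioi 0) = ρ (Set.Iio 0) := by
  -- `ENNReal.ofReal` truncates at zero, so the two sides are the positive and negative parts of
  -- `-Re G_ρ(iy)`, ready for Tonelli.
  have key (y : ℝ) (hy : 0 < y) :
      ∫⁻ x, ENNReal.ofReal (x / (x ^ 2 + y ^ 2)) ∂ρ =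
        ∫⁻ x, ENNReal.ofReal (-x / (x ^ 2 + y ^ 2)) ∂ρ := by
    have hint : Integrable (fun x : ℝ => x / (x ^ 2 + y ^ 2)) ρ := by
      refine Integrable.of_bound (Measurable.aestronglyMeasurable (by fun_prop)) y⁻¹
        (ae_of_all _ fun x => ?_)
      rw [norm_div, Real.norm_of_nonneg (by positivity : 0 ≤ x ^ 2 + y ^ 2),
        div_le_iff₀ (by positivity), Real.norm_eq_abs, inv_mul_eq_div, le_div_iff₀ hy]
      nlinarith [sq_nonneg (|x| - y), sq_abs x, abs_nonneg x]
    have h0 := h y hy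
    rw [cauchyTransform_mul_I_re ρ hy, neg_eq_zero,
      integral_eq_lintegral_pos_part_sub_lintegral_neg_part hint, sub_eq_zero] at h0
    simp only [neg_div]
    exact (ENNReal.toReal_eq_toReal_iff' hint.lintegral_lt_top.ne
      hint.neg.lintegral_lt_top.ne).1 h0
  have hswap (f : ℝ → ℝ) (hf : Measurable f) :
      ∫⁻ y in Set.Ioi (0 : ℝ), ∫⁻ x, ENNReal.ofReal (f x / (x ^ 2 + y ^ 2)) ∂ρ =
        ∫⁻ x, (∫⁻ y in Set.Ioi (0 : ℝ), ENNReal.ofReal (f x / (x ^ 2 + y ^ 2))) ∂ρ :=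
    lintegral_lintegral_swap (μ := volume.restrict (Set.Ioi (0 : ℝ))) (ν := ρ)
      (f := fun y x => ENNReal.ofReal (f x / (x ^ 2 + y ^ 2)))
      (Measurable.aemeasurable (by unfold Function.uncurry; fun_prop))
  have hpos (x : ℝ) : ∫⁻ y in Set.Ioi (0 : ℝ), ENNReal.ofReal (x / (x ^ 2 + y ^ 2)) =
      (Set.Ioi 0).indicator (fun _ => ENNReal.ofReal (Real.pi / 2)) x := by
    by_cases hx : 0 < x
    · rw [Set.indicator_of_mem (Set.mem_Ioi.2 hx), lintegral_Ioi_poisson hx]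
    · rw [Set.indicator_of_notMem (by simpa using hx)]
      have (y : ℝ) : ENNReal.ofReal (x / (x ^ 2 + y ^ 2)) = 0 :=
        ENNReal.ofReal_of_nonpos (div_nonpos_of_nonpos_of_nonneg (not_lt.1 hx) (by positivity))
      simp [this]
  have hneg (x : ℝ) : ∫⁻ y in Set.Ioi (0 : ℝ), ENNReal.ofReal (-x / (x ^ 2 + y ^ 2)) =
      (Set.Iio 0).indicator (fun _ => ENNReal.ofReal (Real.pi / 2)) x := by
    have := hpos (-x)
    rw [neg_sq] at this
    rw [this]
    simp [Set.indicator]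
  have hfin := setLIntegral_congr_fun (μ := volume) (measurableSet_Ioi (a := (0 : ℝ))) key
  rw [hswap (fun x => x) (by fun_prop), hswap (fun x => -x) (by fun_prop)] at hfin
  simp_rw [hpos, hneg] at hfin
  rw [lintegral_indicator_const measurableSet_Ioi, lintegral_indicator_const measurableSet_Iio]
    at hfin
  exact (ENNReal.mul_right_inj (by simp [Real.pi_pos]) ENNReal.ofReal_ne_top).1 hfin

/-! ### The sign coupling -/

theorem map_ite_one_neg_one (ν : Measure ℝ) {S : Set ℝ} [DecidablePred (· ∈ S)]
    (hS : MeasurableSet S) :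
    ν.map (fun x => if x ∈ S then (1 : ℝ) else -1) =
      ν S • Measure.dirac 1 + ν Sᶜ • Measure.dirac (-1) := by
  have hmeas : Measurable fun x => if x ∈ S then (1 : ℝ) else -1 :=
    Measurable.ite hS measurable_const measurable_const
  refine Measure.ext_of_lintegral _ fun f hf => ?_
  rw [lintegral_map hf hmeas, ← lintegral_add_compl _ hS,
    setLIntegral_congr_fun (g := fun _ => f 1) hS fun x hx => by simp [hx],
    setLIntegral_congr_fun (g := fun _ => f (-1)) hS.compl fun x hx => by
      rw [if_neg hx]]
  simp [mul_comm]

/-- The coupling of `ν` with the Rademacher law by signs. -/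
theorem wassersteinDist_rademacher_le (ν : Measure ℝ) [IsProbabilityMeasure ν]
    (hν : ν (Set.Ioi 0) = ν (Set.Iio 0)) :
    wassersteinDist 2 ν rademacher ≤ steinDiscrepancy ν := by
  classical
  set s : Set ℝ → ℝ → ℝ := fun S x => if x ∈ S then 1 else -1 with hs
  have hsm {S : Set ℝ} (hS : MeasurableSet S) : Measurable (s S) :=
    Measurable.ite hS measurable_const measurable_const
  set φ : Set ℝ → ℝ → ℝ × ℝ := fun S x => (x, s S x) with hφ
  have hφm {S : Set ℝ} (hS : MeasurableSet S) : Measurable (φ S) :=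
    measurable_id.prodMk (hsm hS)
  have h1 : MeasurableSet (Set.Ici (0 : ℝ)) := measurableSet_Ici
  have h2 : MeasurableSet (Set.Ioi (0 : ℝ)) := measurableSet_Ioi
  -- The two sign maps differ only at `0`; averaging them splits the atom there evenly.
  set π : Measure (ℝ × ℝ) := (2⁻¹ : ℝ≥0∞) • (ν.map (φ (Set.Ici 0)) + ν.map (φ (Set.Ioi 0))) with hπ
  have hhalf (m : Measure ℝ) : (2⁻¹ : ℝ≥0∞) • (m + m) = m := by
    rw [← two_smul ℝ≥0∞ m, smul_smul, ENNReal.inv_mul_cancel two_ne_zero ENNReal.ofNat_ne_top,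
      one_smul]
  have hfst {S : Set ℝ} (hS : MeasurableSet S) : (ν.map (φ S)).map Prod.fst = ν := by
    rw [Measure.map_map measurable_fst (hφm hS)]
    exact Measure.map_id
  have hsnd {S : Set ℝ} (hS : MeasurableSet S) : (ν.map (φ S)).map Prod.snd =
      ν S • Measure.dirac 1 + ν Sᶜ • Measure.dirac (-1) := by
    rw [Measure.map_map measurable_snd (hφm hS), ← map_ite_one_neg_one ν hS]
    rfl
  have hcoup : IsCoupling ν rademacher π := by
    constructor
    · rw [hπ, Measure.map_smul, Measure.map_add _ _ measurable_fst, hfst h1, hfst h2, hhalf]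
    · have e1 : ν (Set.Ici 0) + ν (Set.Ioi 0) = 1 := by
        rw [hν, ← Set.compl_Ici, prob_add_prob_compl h1]
      have e2 : ν (Set.Ici 0)ᶜ + ν (Set.Ioi 0)ᶜ = 1 := by
        rw [Set.compl_Ici, ← hν, prob_add_prob_compl h2]
      rw [hπ, Measure.map_smul, Measure.map_add _ _ measurable_snd, hsnd h1, hsnd h2,
        add_add_add_comm, ← add_smul, ← add_smul, e1, e2, one_smul, one_smul, add_comm]
      rfl
  refine (iInf₂_le π hcoup).trans ?_
  unfold steinDiscrepancy
  refine ENNReal.rpow_le_rpow ?_ (by norm_num)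
  have hcost {S : Set ℝ} (hS : MeasurableSet S) (hS1 : Set.Ioi 0 ⊆ S) (hS2 : S ⊆ Set.Ici 0) :
      ∫⁻ p : ℝ × ℝ, ENNReal.ofReal (|p.1 - p.2| ^ (2 : ℝ)) ∂(ν.map (φ S)) ≤
        ∫⁻ x : ℝ, ENNReal.ofReal ((x ^ 2 - 1) ^ 2) ∂ν := by
    rw [lintegral_map (by fun_prop) (hφm hS)]
    refine lintegral_mono fun x => ENNReal.ofReal_le_ofReal ?_
    rw [Real.rpow_two, sq_abs]
    -- On each side `(|x|-1)² ≤ (|x|-1)²(|x|+1)²`, as `|x| + 1 ≥ 1`.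
    by_cases hx : x ∈ S
    · have hx0 : 0 ≤ x := hS2 hx
      simp only [hφ, hs, if_pos hx]
      nlinarith [mul_nonneg (sq_nonneg (x - 1)) (by nlinarith : 0 ≤ (x + 1) ^ 2 - 1)]
    · have hx0 : x ≤ 0 := not_lt.1 fun h => hx (hS1 h)
      simp only [hφ, hs, if_neg hx]
      nlinarith [mul_nonneg (sq_nonneg (x + 1)) (by nlinarith : 0 ≤ (x - 1) ^ 2 - 1)]
  rw [hπ, lintegral_smul_measure, lintegral_add_measure, smul_eq_mul]
  calc (2⁻¹ : ℝ≥0∞) * _ ≤ 2⁻¹ * (∫⁻ x : ℝ, ENNReal.ofReal ((x ^ 2 - 1) ^ 2) ∂ν +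
        ∫⁻ x : ℝ, ENNReal.ofReal ((x ^ 2 - 1) ^ 2) ∂ν) := by
        gcongr
        · exact hcost h1 Set.Ioi_subset_Ici_self subset_rfl
        · exact hcost h2 subset_rfl Set.Ioi_subset_Ici_self
    _ = _ := by
        rw [← two_mul, ← mul_assoc, ENNReal.inv_mul_cancel two_ne_zero ENNReal.ofNat_ne_top,
          one_mul]

/-! ### The Berry–Esseen bound -/

theorem mainTheorem9 (μ : Measure ℝ) [IsProbabilityMeasure μ]
    (hsymm : μ.map (fun x : ℝ => -x) = μ)
    (hm2 : ∫ x : ℝ, x ^ 2 ∂μ = 1)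
    (hm4 : Integrable (fun x : ℝ => x ^ 4) μ)
    (n : ℕ) (hn : 1 ≤ n) :
    wassersteinDist 2 (booleanCLT μ n) rademacher ≤ steinDiscrepancy (booleanCLT μ n) ∧
      steinDiscrepancy (booleanCLT μ n) =
        ENNReal.ofReal (1 / √(n : ℝ) * √((∫ x : ℝ, x ^ 4 ∂μ) - 1)) := by
  have hi2 : Integrable (fun x : ℝ => x ^ 2) μ := by
    by_contra h
    rw [integral_undef h] at hm2
    exact zero_ne_one hm2
  obtain ⟨hρ, hK⟩ := booleanPow_spec μ hi2 n
  unfold booleanCLT dilation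
  set ρ := booleanPow μ n
  have hn1 : (1 : ℝ) ≤ n := by exact_mod_cast hn
  have hn0 : (0 : ℝ) < n := by linarith
  have hpow (y : ℝ) (hy : 0 < y) := cauchyTransform_mul_I_re_im_of_selfEnergy_eq (ρ := ρ)
    (t := n) hy (cauchyTransform_mul_I_re_eq_zero_of_symm μ hsymm hy)
    (by simpa using hK _ (mul_I_im_pos hy))
  obtain ⟨⟨hρ2, hρ2'⟩, hρ4, hρ4'⟩ :=
    moments_of_booleanPower (ρ := ρ) hn1 hm2 hm4 fun y hy => (hpow y hy).2
  have hc : 0 < 1 / √(n : ℝ) := by positivity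
  have hdil : Measurable fun x : ℝ => 1 / √(n : ℝ) * x := by fun_prop
  have := Measure.isProbabilityMeasure_map (μ := ρ) hdil.aemeasurable
  refine ⟨wassersteinDist_rademacher_le _ ?_, ?_⟩
  · rw [Measure.map_apply hdil measurableSet_Ioi, Measure.map_apply hdil measurableSet_Iio]
    convert measure_Ioi_eq_measure_Iio ρ fun y hy => (hpow y hy).1 using 2
    · ext x; simp [hn0]
    · ext x; exact ⟨fun h => neg_of_mul_neg_right h hc.le, fun h => mul_neg_of_pos_of_neg hc h⟩
  · have hc2 (x : ℝ) : ((1 / √(n : ℝ) * x) ^ 2 - 1) ^ 2 =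
        ((n : ℝ) ^ 2)⁻¹ * x ^ 4 - 2 / n * x ^ 2 + 1 := by
      rw [mul_pow, div_pow, Real.sq_sqrt hn0.le]
      field_simp
      ring
    have hint : Integrable
        (fun x : ℝ => ((n : ℝ) ^ 2)⁻¹ * x ^ 4 - 2 / n * x ^ 2 + 1) ρ :=
      ((hρ4.const_mul _).sub (hρ2.const_mul _)).add (integrable_const _)
    -- The moments give `(m₄ + n - 1)/n - 2 + 1`.
    have hval : ∫ x : ℝ, (((n : ℝ) ^ 2)⁻¹ * x ^ 4 - 2 / n * x ^ 2 + 1) ∂ρ =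
        ((∫ x : ℝ, x ^ 4 ∂μ) - 1) / n := by
      rw [integral_add (f := fun x : ℝ => ((n : ℝ) ^ 2)⁻¹ * x ^ 4 - 2 / n * x ^ 2)
          ((hρ4.const_mul _).sub (hρ2.const_mul _)) (integrable_const _),
        integral_sub (hρ4.const_mul _) (hρ2.const_mul _), integral_const_mul, integral_const_mul,
        hρ2', hρ4']
      simp
      field_simp
      ring
    have hnn (x : ℝ) : 0 ≤ ((n : ℝ) ^ 2)⁻¹ * x ^ 4 - 2 / n * x ^ 2 + 1 := by
      rw [← hc2]; positivity
    have hval0 : 0 ≤ ((∫ x : ℝ, x ^ 4 ∂μ) - 1) / n := hval ▸ integral_nonneg hnn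
    unfold steinDiscrepancy
    rw [lintegral_map (by fun_prop) hdil]
    simp_rw [hc2]
    rw [← ofReal_integral_eq_lintegral_ofReal hint (ae_of_all _ hnn), hval,
      ENNReal.ofReal_rpow_of_nonneg hval0 (by norm_num), ← Real.sqrt_eq_rpow,
      Real.sqrt_div' _ hn0.le]
    congr 1
    ring
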